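/- Let $R$ be a ring, $J$ an injective $R$-module and $E=\operatorname{End}_R(J)$, acting on $J$ by evaluation, so that the actions of $R$ and $E$ on $J$ commute. (As $J$ is injective, it is its own injective resolution, and the derived endomorphism dg-algebra $\mathbb{R}\mathrm{End}_R(J)$ is the ring $E$ placed in degree $0$; for right instead of left modules one uses $E^{\mathrm{op}}$.) For a complex $C$ of $R$-modules put $C^{\circledast}=\mathbb{R}\mathrm{Hom}_R(C,J)=\mathrm{Hom}_R^{\bullet}(C,J)$, a complex of $E$-modules, and let $C^{\circledast\circledast}=\mathbb{R}\mathrm{Hom}_E(C^{\circledast},J)$, the complex of $R$-modules $\mathrm{Hom}_E^{\bullet}(P,J)$, where $P\xrightarrow{\ \sim\ }C^{\circledast}$ is a K-projective resolution over $E$. The derived evaluation map $\epsilon_C\colon C\to C^{\circledast\circledast}$ is the composite $$C\longrightarrow \mathrm{Hom}_E^{\bullet}(\mathrm{Hom}_R^{\bullet}(C,J),J)\longrightarrow \mathrm{Hom}_E^{\bullet}(P,J)$$ of $m\mapsto\bigl(f\mapsto(-1)^{\deg m\,\deg f}f(m)\bigr)$ with the map induced by $P\to C^{\circledast}$. Let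 $M$ be an $R$-module, regarded as a complex in degree $0$, that admits an injective resolution $$0\to M\to J^0\to J^1\to J^2\to\cdots$$ in which each $J^i$ is a direct summand of a finite direct sum of copies of $J$. Then K-projective resolutions $P\to M^{\circledast}$ exist, and for each of them the derived evaluation map $\epsilon_M\colon M\to M^{\circledast\circledast}$ is a quasi-isomorphism. -/

import Mathlib

open CategoryTheory

universe u u' v

noncomputable section

namespace DerivedBidual

section Dual

variable (A : Type u) (B : Type u') [Ring A] [Ring B]
variable (J : Type v) [AddCommGroup J] [Module A J] [Module B J] [SMulCommClass A B J]

/-- Precomposition with an `A`-linear map `f : X → Y`, as a `B`-linear map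
`Hom_A(Y, J) → Hom_A(X, J)`; here `B` acts on both sides through its action on `J`. -/
def precomp {X Y : Type v} [AddCommGroup X] [AddCommGroup Y] [Module A X] [Module A Y]
    (f : X →ₗ[A] Y) : (Y →ₗ[A] J) →ₗ[B] (X →ₗ[A] J) where
  toFun φ := φ.comp f
  map_add' _ _ := rfl
  map_smul' _ _ := rfl

/-- The Hom complex `Hom_A^•(C, J)` of a cochain complex `C` of `A`-modules into the module `J`
placed in degree `0`, as a cochain complex of `B`-modules. Its term of degree `n` is
`Hom_A(C^{-n}, J)` and its differential is the usual one,
`d φ = d_J ∘ φ - (-1)^n φ ∘ d_C = (-1)^(n+1) φ ∘ d_C`. -/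
def dual (C : CochainComplex (ModuleCat.{v} A) ℤ) : CochainComplex (ModuleCat.{v} B) ℤ where
  X n := ModuleCat.of B (C.X (-n) →ₗ[A] J)
  d i j := j.negOnePow • ModuleCat.ofHom (precomp A B J (C.d (-j) (-i)).hom)
  shape i j hij := by
    have h : C.d (-j) (-i) = 0 := C.shape _ _ (by
      simp only [ComplexShape.up_Rel] at hij ⊢
      omega)
    ext φ x
    simp [h, precomp, Units.smul_def]
  d_comp_d' i j k _ _ := by
    rw [Linear.units_smul_comp, Linear.comp_units_smul]
    have h : ModuleCat.ofHom (precomp A B J (C.d (-j) (-i)).hom) ≫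
        ModuleCat.ofHom (precomp A B J (C.d (-k) (-j)).hom) = 0 := by
      ext φ x
      have := congrArg (fun g => g.hom x) (C.d_comp_d (-k) (-j) (-i))
      simp only [ModuleCat.hom_comp, LinearMap.comp_apply] at this
      change φ ((C.d (-j) (-i)).hom ((C.d (-k) (-j)).hom x)) = 0
      rw [this]
      exact map_zero φ
    rw [h, smul_zero, smul_zero]

/-- The map `Hom_A^•(D, J) → Hom_A^•(C, J)`, `φ ↦ φ ∘ f`, induced by a morphism `f : C → D`. -/
def dualMap {C D : CochainComplex (ModuleCat.{v} A) ℤ} (f : C ⟶ D) :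
    dual A B J D ⟶ dual A B J C where
  f n := ModuleCat.ofHom (precomp A B J (f.f (-n)).hom)
  comm' i j _ := by
    dsimp only [dual]
    rw [Linear.comp_units_smul, Linear.units_smul_comp]
    congr 1
    ext φ x
    have := congrArg (fun g => g.hom x) (f.comm (-j) (-i))
    simp only [ModuleCat.hom_comp, LinearMap.comp_apply] at this
    exact congrArg φ this.symm

variable [SMulCommClass B A J]

/-- The evaluation `X → Hom_B(Hom_A(X, J), J)`, `x ↦ (φ ↦ φ x)`. -/
def evalHom (X : Type v) [AddCommGroup X] [Module A X] :
    X →ₗ[A] ((X →ₗ[A] J) →ₗ[B] J) where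
  toFun x :=
    { toFun := fun φ => φ x
      map_add' := fun _ _ => rfl
      map_smul' := fun _ _ => rfl }
  map_add' x y := by
    ext φ
    exact map_add φ x y
  map_smul' a x := by
    ext φ
    exact map_smul φ a x

/-- The evaluation morphism `C → Hom_B^•(Hom_A^•(C, J), J)` of complexes of `A`-modules. It sends
`m ∈ C^p` to `φ ↦ (-1)^(deg m * deg φ) φ(m)`, where `φ ∈ Hom_A(C^p, J)` has degree `-p`, so that
the sign is `(-1)^p`. The isomorphism `XIsoOfEq` identifies `C^p` with `C^{-(-p)}`. -/
def eval (C : CochainComplex (ModuleCat.{v} A) ℤ) :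
    C ⟶ dual B A J (dual A B J C) where
  f p := p.negOnePow •
    ((C.XIsoOfEq (neg_neg p).symm).hom ≫ ModuleCat.ofHom (evalHom A B J (C.X (-(-p)))))
  comm' p q hpq := by
    obtain rfl : p + 1 = q := hpq
    have hd := C.XIsoOfEq_hom_comp_d (neg_neg p).symm (-(-(p + 1)))
    have hd' := C.d_comp_XIsoOfEq_hom (neg_neg (p + 1)).symm p
    have hs : p.negOnePow * (p + 1).negOnePow * (-p).negOnePow = (p + 1).negOnePow := by
      rw [Int.negOnePow_neg, mul_right_comm, ← Int.negOnePow_add, Int.negOnePow_even _ ⟨p, rfl⟩,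
        one_mul]
    have key : ((C.XIsoOfEq (neg_neg p).symm).hom ≫
          ModuleCat.ofHom (evalHom A B J (C.X (-(-p))))) ≫
        ModuleCat.ofHom (precomp B A J
          (ModuleCat.ofHom (precomp A B J (C.d (-(-p)) (-(-(p + 1)))).hom)).hom) =
        C.d p (p + 1) ≫ (C.XIsoOfEq (neg_neg (p + 1)).symm).hom ≫
          ModuleCat.ofHom (evalHom A B J (C.X (-(-(p + 1))))) := by
      rw [← Category.assoc (C.d p (p + 1)), hd', ← hd]
      rfl
    have hdd : (dual B A J (dual A B J C)).d p (p + 1) = ((p + 1).negOnePow * (-p).negOnePow) •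
        ModuleCat.ofHom (precomp B A J
          (ModuleCat.ofHom (precomp A B J (C.d (-(-p)) (-(-(p + 1)))).hom)).hom) := by
      rw [mul_smul]
      dsimp only [dual]
      congr 1
      ext ψ φ
      exact (ψ.toAddMonoidHom.map_zsmul _ _)
    have hgen : ∀ {X Y Z W : ModuleCat.{v} A} (f : X ⟶ Y) (g : Y ⟶ Z) (h : X ⟶ W) (k : W ⟶ Z)
        (s t r : ℤˣ), f ≫ g = h ≫ k → s * t = r → (s • f) ≫ (t • g) = h ≫ (r • k) := by
      intro X Y Z W f g h k s t r hfg hst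
      rw [Linear.units_smul_comp, Linear.comp_units_smul, Linear.comp_units_smul, hfg, smul_smul,
        hst]
    rw [hdd]
    exact hgen _ _ _ _ _ _ _ key (by rw [← mul_assoc, hs])

end Dual

/-- A K-projective resolution of a cochain complex `N`: a quasi-isomorphism `P → N` from a
K-projective complex. It computes `ℝHom(N, -)` as `Hom^•(P, -)`. -/
structure KProjectiveResolution {A : Type u} [Ring A]
    (N : CochainComplex (ModuleCat.{v} A) ℤ) where
  /-- The resolving complex. -/
  P : CochainComplex (ModuleCat.{v} A) ℤ
  /-- The resolving complex is K-projective. -/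
  isKProjective : P.IsKProjective
  /-- The augmentation. -/
  π : P ⟶ N
  /-- The augmentation is a quasi-isomorphism. -/
  quasiIso : QuasiIso π

section Bidual

variable (R : Type u) [Ring R] (J : Type v) [AddCommGroup J] [Module R J]

/-- The derived dual `M^⊛ = ℝHom_R(M, J)` of a complex `M` of `R`-modules, as a complex of modules
over `E = End_R(J)`, for an *injective* `R`-module `J`. Such a `J`, placed in degree `0`, is its own
injective resolution, so that the Hom complexes `Hom_R^•(-, J)` compute `ℝHom_R(-, J)`; for the
same reason the dg-algebra `ℝEnd_R(J)` is the ring `E`, placed in degree `0`, and dg-modules over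
it are complexes of `E`-modules. With left `R`-modules, `J` and `Hom_R(M, J)` are left modules over
`E` (with right modules throughout they are right modules over the opposite ring). -/
abbrev derivedDual (M : CochainComplex (ModuleCat.{v} R) ℤ) :
    CochainComplex (ModuleCat.{v} (Module.End R J)) ℤ :=
  dual R (Module.End R J) J M

variable {R}

/-- The derived bidual `M^⊛⊛ = ℝHom_E(M^⊛, J)`, as a complex of `R`-modules, computed by means of a
K-projective resolution `P → M^⊛` of complexes of `E`-modules: it is `Hom_E^•(P, J)`. -/
abbrev derivedBidual {M : CochainComplex (ModuleCat.{v} R) ℤ}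
    (Q : KProjectiveResolution (derivedDual R J M)) : CochainComplex (ModuleCat.{v} R) ℤ :=
  dual (Module.End R J) R J Q.P

/-- The derived evaluation map `M → M^⊛⊛`: the evaluation `M → Hom_E^•(Hom_R^•(M, J), J)` followed
by the canonical map `Hom_E^•(M^⊛, J) → ℝHom_E(M^⊛, J)`. -/
def derivedEval {M : CochainComplex (ModuleCat.{v} R) ℤ}
    (Q : KProjectiveResolution (derivedDual R J M)) : M ⟶ derivedBidual J Q :=
  eval R (Module.End R J) J M ≫ dualMap (Module.End R J) R J Q.π

variable (R)

/-- The `R`-module `X` is a direct summand of a finite direct sum of copies of `J`. -/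
def IsSummandOfFiniteSum (X : Type v) [AddCommGroup X] [Module R X] : Prop :=
  ∃ (n : ℕ) (i : X →ₗ[R] (Fin n → J)) (r : (Fin n → J) →ₗ[R] X), r ∘ₗ i = LinearMap.id

end Bidual

end DerivedBidual

end

/-! Let `M → D` be the given resolution. Since `J` is injective over `R`, `Hom_R(-, J)` preserves
quasi-isomorphisms, so `D^⊛ → M^⊛` is one (`quasiIso_dualMap`). For a summand `X` of `Jⁿ`, `Hom_R(X,
J)` is a summand of `Eⁿ`, hence projective, and `X → Hom_E(Hom_R(X, J), J)` is bijective, as in the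
case `Hom_E(E, J) = J`. So `D^⊛`, being bounded above, is a K-projective resolution of `M^⊛`, and
evaluation on `D` is an isomorphism. By naturality the derived evaluation for this resolution is `M
→ D` followed by that isomorphism.

Any other K-projective resolution is homotopy equivalent to `D^⊛` over `M^⊛`, up to homotopy, and
`Hom_E^•(-, J)` respects homotopies; `J` need not be injective over `E`. -/

noncomputable section

/-! ### Quasi-isomorphisms in terms of elements -/

namespace CategoryTheory.ShortComplex

/-- A morphism of short complexes of modules is a quasi-isomorphism if and only if it is injective
and surjective on homology, in terms of elements. -/
lemma moduleCat_quasiIso_iff {R : Type u} [Ring R] {S₁ S₂ : ShortComplex (ModuleCat.{v} R)}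
    (φ : S₁ ⟶ S₂) :
    QuasiIso φ ↔
      (∀ x : S₁.X₂, S₁.g x = 0 → φ.τ₂ x ∈ LinearMap.range S₂.f.hom →
        x ∈ LinearMap.range S₁.f.hom) ∧
      (∀ y : S₂.X₂, S₂.g y = 0 → ∃ x : S₁.X₂, S₁.g x = 0 ∧
        φ.τ₂ x - y ∈ LinearMap.range S₂.f.hom) := by
  set h₁ := S₁.moduleCatLeftHomologyData
  set h₂ := S₂.moduleCatLeftHomologyData
  have hmem {S : ShortComplex (ModuleCat.{v} R)} (x : LinearMap.ker S.g.hom) :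
      x ∈ LinearMap.range S.moduleCatToCycles ↔ x.1 ∈ LinearMap.range S.f.hom := by
    constructor
    · rintro ⟨w, rfl⟩
      exact ⟨w, rfl⟩
    · rintro ⟨w, hw⟩
      exact ⟨w, Subtype.ext hw⟩
  have hi (x : LinearMap.ker S₁.g.hom) :
      Subtype.val (p := fun y => y ∈ LinearMap.ker S₂.g.hom) (cyclesMap' φ h₁ h₂ x) = φ.τ₂ x.1 :=
    congrArg (fun k => k.hom x) (cyclesMap'_i φ h₁ h₂)
  have hπ (x : LinearMap.ker S₁.g.hom) :
      leftHomologyMap' φ h₁ h₂ ((LinearMap.range S₁.moduleCatToCycles).mkQ x) =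
        (LinearMap.range S₂.moduleCatToCycles).mkQ (cyclesMap' φ h₁ h₂ x) :=
    congrArg (fun k => k.hom x) (leftHomologyπ_naturality' φ h₁ h₂)
  rw [quasiIso_iff_isIso_leftHomologyMap' φ h₁ h₂,
    ConcreteCategory.isIso_iff_bijective]
  refine and_congr ?_ ?_
  · refine (injective_iff_map_eq_zero (leftHomologyMap' φ h₁ h₂).hom).trans ?_
    constructor
    · intro H x hx hφ
      have := H ((LinearMap.range S₁.moduleCatToCycles).mkQ ⟨x, hx⟩) (by
        refine (hπ ⟨x, hx⟩).trans ?_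
        refine (Submodule.Quotient.mk_eq_zero _).2 ((hmem _).2 ?_)
        rw [hi]
        exact hφ)
      exact (hmem _).1 ((Submodule.Quotient.mk_eq_zero _).1 this)
    · intro H a ha
      obtain ⟨x, rfl⟩ := Submodule.mkQ_surjective _ a
      refine (Submodule.Quotient.mk_eq_zero _).2 ((hmem _).2 (H x.1 x.2 ?_))
      have := (hmem _).1 ((Submodule.Quotient.mk_eq_zero _).1 ((hπ x).symm.trans ha))
      rwa [hi] at this
  · constructor
    · intro H y hy
      obtain ⟨a, ha⟩ := H ((LinearMap.range S₂.moduleCatToCycles).mkQ ⟨y, hy⟩)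
      obtain ⟨x, rfl⟩ := Submodule.mkQ_surjective _ a
      have := (hmem _).1 ((Submodule.Quotient.eq _).1 ((hπ x).symm.trans ha))
      refine ⟨x.1, x.2, ?_⟩
      rw [← hi]
      exact this
    · intro H b
      obtain ⟨y, rfl⟩ := Submodule.mkQ_surjective _ b
      obtain ⟨x, hx, hxy⟩ := H y.1 y.2
      refine ⟨(LinearMap.range S₁.moduleCatToCycles).mkQ ⟨x, hx⟩, (hπ ⟨x, hx⟩).trans ?_⟩
      refine (Submodule.Quotient.eq _).2 ((hmem _).2 ?_)
      change Subtype.val (p := fun y => y ∈ LinearMap.ker S₂.g.hom)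
        (cyclesMap' φ h₁ h₂ _) - y.1 ∈ _
      rw [hi]
      exact hxy

end CategoryTheory.ShortComplex

namespace DerivedBidual

/-! ### Hom complexes into `J`: naturality, homotopies, exactness -/

section Dual

variable (A : Type u) (B : Type u') [Ring A] [Ring B]
variable (J : Type v) [AddCommGroup J] [Module A J] [Module B J] [SMulCommClass A B J]

/-- Precomposition with a morphism `C^{-j} → D^{-i}`, as a morphism from the term of degree `i` of
`Hom_A^•(D, J)` to the term of degree `j` of `Hom_A^•(C, J)`. -/
def dualTermMap {C D : CochainComplex (ModuleCat.{v} A) ℤ} {i j : ℤ} (k : C.X (-j) ⟶ D.X (-i)) :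
    (dual A B J D).X i ⟶ (dual A B J C).X j :=
  ModuleCat.ofHom (precomp A B J k.hom)

lemma dual_d (C : CochainComplex (ModuleCat.{v} A) ℤ) (i j : ℤ) :
    (dual A B J C).d i j = j.negOnePow • dualTermMap A B J (C.d (-j) (-i)) := rfl

lemma dualMap_f {C D : CochainComplex (ModuleCat.{v} A) ℤ} (f : C ⟶ D) (n : ℤ) :
    (dualMap A B J f).f n = dualTermMap A B J (f.f (-n)) := rfl

lemma dualTermMap_comp {C D K : CochainComplex (ModuleCat.{v} A) ℤ} {i j k : ℤ}
    (f : C.X (-k) ⟶ D.X (-j)) (g : D.X (-j) ⟶ K.X (-i)) :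
    dualTermMap A B J g ≫ dualTermMap A B J f = dualTermMap A B J (f ≫ g) := rfl

lemma dualTermMap_zero {C D : CochainComplex (ModuleCat.{v} A) ℤ} {i j : ℤ} :
    dualTermMap A B J (0 : C.X (-j) ⟶ D.X (-i)) = 0 := by
  refine ModuleCat.hom_ext (LinearMap.ext fun φ => LinearMap.ext fun _ => ?_)
  exact map_zero (M := D.X (-i)) (show D.X (-i) →ₗ[A] J from φ)

lemma dualTermMap_add {C D : CochainComplex (ModuleCat.{v} A) ℤ} {i j : ℤ}
    (f g : C.X (-j) ⟶ D.X (-i)) :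
    dualTermMap A B J (f + g) = dualTermMap A B J f + dualTermMap A B J g := by
  refine ModuleCat.hom_ext (LinearMap.ext fun φ => LinearMap.ext fun _ => ?_)
  exact map_add (M := D.X (-i)) (show D.X (-i) →ₗ[A] J from φ) _ _

/-- The evaluation in degree `p`, without its sign. -/
def unsignedEval [SMulCommClass B A J] (C : CochainComplex (ModuleCat.{v} A) ℤ) (p : ℤ) :
    C.X p ⟶ (dual B A J (dual A B J C)).X p :=
  (C.XIsoOfEq (neg_neg p).symm).hom ≫ ModuleCat.ofHom (evalHom A B J (C.X (-(-p))))

lemma eval_f [SMulCommClass B A J] (C : CochainComplex (ModuleCat.{v} A) ℤ) (p : ℤ) :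
    (eval A B J C).f p = p.negOnePow • unsignedEval A B J C p := rfl

lemma unsignedEval_naturality [SMulCommClass B A J] {C D : CochainComplex (ModuleCat.{v} A) ℤ}
    (f : C ⟶ D) (p : ℤ) :
    f.f p ≫ unsignedEval A B J D p =
      unsignedEval A B J C p ≫ (dualMap B A J (dualMap A B J f)).f p := by
  have h := HomologicalComplex.XIsoOfEq_hom_naturality f (neg_neg p).symm
  refine (Category.assoc _ _ _).symm.trans ?_
  rw [h]
  rfl

lemma eval_naturality [SMulCommClass B A J] {C D : CochainComplex (ModuleCat.{v} A) ℤ}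
    (f : C ⟶ D) :
    f ≫ eval A B J D = eval A B J C ≫ dualMap B A J (dualMap A B J f) := by
  ext1 p
  rw [HomologicalComplex.comp_f, HomologicalComplex.comp_f, eval_f, eval_f,
    Linear.comp_units_smul, Linear.units_smul_comp, unsignedEval_naturality]

/-- The Hom complex into `J` turns homotopic morphisms into homotopic morphisms. -/
def dualHomotopy {C D : CochainComplex (ModuleCat.{v} A) ℤ} {f g : C ⟶ D}
    (h : Homotopy f g) : Homotopy (dualMap A B J f) (dualMap A B J g) where
  -- The sign matches that of the adjacent differential: both are `(-1)^(n+1)` in `d ≫ hom` and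
  -- `(-1)^n` in `hom ≫ d`, so they cancel. Dualizing swaps these two terms.
  hom i j := i.negOnePow • dualTermMap A B J (h.hom (-j) (-i))
  zero i j hij := by
    rw [h.zero _ _ (by simp only [ComplexShape.up_Rel] at hij ⊢; omega), dualTermMap_zero,
      smul_zero]
  comm n := by
    have hc := h.comm (-n)
    rw [dNext_eq (i' := -(n - 1)) _ (by simp only [ComplexShape.up_Rel]; omega),
      prevD_eq (j' := -(n + 1)) _ (by simp only [ComplexShape.up_Rel]; omega)] at hc
    rw [dNext_eq (i' := n + 1) _ (by simp), prevD_eq (j' := n - 1) _ (by simp)]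
    simp only [dual_d, dualMap_f, Linear.comp_units_smul, Linear.units_smul_comp, smul_smul,
      dualTermMap_comp]
    rw [← Int.negOnePow_add, ← Int.negOnePow_add, Int.negOnePow_even _ ⟨n + 1, rfl⟩,
      Int.negOnePow_even _ ⟨n, rfl⟩, one_smul, one_smul, hc, dualTermMap_add, dualTermMap_add,
      add_comm (dualTermMap A B J (C.d _ _ ≫ _))]

-- Needs no injectivity, so it applies over `E`.
open HomologicalComplex in
lemma quasiIso_dualMap_of_homotopyEquivalences {C D : CochainComplex (ModuleCat.{v} A) ℤ}
    {f : C ⟶ D} (hf : homotopyEquivalences _ _ f) : QuasiIso (dualMap A B J f) := by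
  obtain ⟨e, rfl⟩ := hf
  let e' : HomotopyEquiv (dual A B J D) (dual A B J C) :=
    { hom := dualMap A B J e.hom
      inv := dualMap A B J e.inv
      homotopyHomInvId := dualHomotopy A B J e.homotopyInvHomId
      homotopyInvHomId := dualHomotopy A B J e.homotopyHomInvId }
  exact e'.quasiIso_hom

variable {A J}

/-- A linear map into an injective module factors through `d` if it vanishes on the kernel
of `d`. -/
lemma exists_comp_eq_of_ker_le (hJ : Module.Injective A J) {X Y : Type v} [AddCommGroup X]
    [AddCommGroup Y] [Module A X] [Module A Y] (d : X →ₗ[A] Y) (φ : X →ₗ[A] J)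
    (h : LinearMap.ker d ≤ LinearMap.ker φ) : ∃ χ : Y →ₗ[A] J, χ ∘ₗ d = φ := by
  -- `X / ker d` embeds in `Y`; the map induced by `φ` extends along this embedding.
  obtain ⟨χ, hχ⟩ := hJ.out ((LinearMap.ker d).liftQ d le_rfl)
    (LinearMap.ker_eq_bot.1 (Submodule.ker_liftQ_eq_bot _ _ _ le_rfl))
    ((LinearMap.ker d).liftQ φ h)
  exact ⟨χ, LinearMap.ext fun x => hχ (Submodule.Quotient.mk x)⟩


/-- The Hom complex into an injective module preserves quasi-isomorphisms. -/
lemma quasiIso_dualMap (hJ : Module.Injective A J) {C D : CochainComplex (ModuleCat.{v} A) ℤ}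
    (f : C ⟶ D) [QuasiIso f] : QuasiIso (dualMap A B J f) := by
  -- The signs in the differential of the dual change neither its range nor its kernel.
  have hrange {K : CochainComplex (ModuleCat.{v} A) ℤ} (i j : ℤ) (φ : K.X (-j) →ₗ[A] J) :
      φ ∈ LinearMap.range ((dual A B J K).d i j).hom ↔
        ∃ χ : K.X (-i) →ₗ[A] J, χ ∘ₗ (K.d (-j) (-i)).hom = φ := by
    rcases Int.even_or_odd j with hj | hj
    · rw [dual_d, Int.negOnePow_even _ hj, one_smul]
      rfl
    · rw [dual_d, Int.negOnePow_odd _ hj, Units.neg_smul, one_smul, ModuleCat.hom_neg,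
        LinearMap.range_neg]
      rfl
  have hker {K : CochainComplex (ModuleCat.{v} A) ℤ} (i j : ℤ) (φ : K.X (-i) →ₗ[A] J) :
      (dual A B J K).d i j φ = 0 ↔ φ ∘ₗ (K.d (-j) (-i)).hom = 0 := by
    rcases Int.even_or_odd j with hj | hj
    · rw [dual_d, Int.negOnePow_even _ hj, one_smul]
      rfl
    · rw [dual_d, Int.negOnePow_odd _ hj, Units.neg_smul, one_smul]
      exact neg_eq_zero
  rw [quasiIso_iff]
  intro n
  have hf : QuasiIsoAt f (-n) := inferInstance
  rw [quasiIsoAt_iff' f (-(n + 1)) (-n) (-(n - 1)) (by simp; omega) (by simp; omega),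
    ShortComplex.moduleCat_quasiIso_iff] at hf
  obtain ⟨hinj, hsurj⟩ := hf
  rw [quasiIsoAt_iff' _ (n - 1) n (n + 1) (by simp) (by simp),
    ShortComplex.moduleCat_quasiIso_iff]
  refine ⟨fun φ hφ hφf => ?_, fun ψ hψ => ?_⟩
  · change D.X (-n) →ₗ[A] J at φ
    replace hφ := (hker n (n + 1) φ).1 hφ
    obtain ⟨χ, hχ⟩ := (hrange (n - 1) n (φ ∘ₗ (f.f (-n)).hom)).1 hφf
    -- `φ` kills every cocycle `z` of `D`: up to a boundary, which `φ` kills, `z` is `f x` with `x`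
    -- a cocycle, and `φ ∘ f = χ ∘ d` kills `x`.
    refine (hrange (n - 1) n φ).2 (exists_comp_eq_of_ker_le hJ _ _ fun z hz => ?_)
    obtain ⟨x, hx, w, hw⟩ := hsurj z hz
    have h₁ : φ ((f.f (-n)).hom x - z) = 0 :=
      (congrArg φ hw).symm.trans (LinearMap.congr_fun hφ w)
    have h₂ : φ ((f.f (-n)).hom x) = 0 :=
      (LinearMap.congr_fun hχ x).symm.trans ((congrArg χ hx).trans (map_zero χ))
    rw [map_sub, h₂, zero_sub, neg_eq_zero] at h₁
    exact h₁
  · change C.X (-n) →ₗ[A] J at ψ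
    replace hψ := (hker n (n + 1) ψ).1 hψ
    let Z := LinearMap.ker (C.d (-n) (-(n - 1))).hom
    let W := LinearMap.range (D.d (-(n + 1)) (-n)).hom
    -- Injectivity of `f` on cohomology makes the kernel of `Z → D/W` consist of boundaries, which
    -- `ψ` kills. So `ψ` on `Z` comes from a map on all of `D/W`, and the difference from `ψ`,
    -- vanishing on `Z`, is a coboundary.
    obtain ⟨φ, hφ⟩ := exists_comp_eq_of_ker_le hJ (W.mkQ ∘ₗ (f.f (-n)).hom ∘ₗ Z.subtype)
      (ψ ∘ₗ Z.subtype) fun z hz => by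
        obtain ⟨w, hw⟩ := hinj z.1 z.2 ((Submodule.Quotient.mk_eq_zero W).1 hz)
        exact (congrArg ψ hw).symm.trans (LinearMap.congr_fun hψ w)
    refine ⟨φ ∘ₗ W.mkQ, (hker n (n + 1) (φ ∘ₗ W.mkQ)).2 ?_, (hrange (n - 1) n
      ((φ ∘ₗ W.mkQ) ∘ₗ (f.f (-n)).hom - ψ)).2 (exists_comp_eq_of_ker_le hJ _ _ fun z hz => ?_)⟩
    · ext w
      exact (congrArg φ ((Submodule.Quotient.mk_eq_zero W).2 ⟨w, rfl⟩)).trans (map_zero φ)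
    · exact sub_eq_zero.2 (LinearMap.congr_fun hφ ⟨z, hz⟩)

end Dual

lemma quasiIso_of_homotopy {A : Type u} [Ring A] {C D : CochainComplex (ModuleCat.{v} A) ℤ}
    {f g : C ⟶ D} (h : Homotopy f g) [QuasiIso f] : QuasiIso g := by
  rw [quasiIso_iff]
  intro n
  rw [quasiIsoAt_iff_isIso_homologyMap, ← h.homologyMap_eq n]
  infer_instance

/-! ### Duality for summands of `Jⁿ` -/

section Summand

variable {R : Type u} [Ring R] {J : Type v} [AddCommGroup J] [Module R J]
variable {X Y : Type v} [AddCommGroup X] [Module R X] [AddCommGroup Y] [Module R Y]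

/-- The dual basis property: linear maps to `J` from a summand `X` of `Jⁿ` are combinations of the
coordinates of the inclusion `X → Jⁿ`. -/
lemma eq_sum_smul_coordinates {n : ℕ} {i : X →ₗ[R] (Fin n → J)} {r : (Fin n → J) →ₗ[R] X}
    (h : r ∘ₗ i = LinearMap.id) (φ : X →ₗ[R] J) :
    φ = ∑ k, (φ ∘ₗ r ∘ₗ LinearMap.single R (fun _ => J) k : Module.End R J) •
      (LinearMap.proj k ∘ₗ i) := by
  ext x
  have hx : r (i x) = x := LinearMap.congr_fun h x
  simp only [LinearMap.sum_apply, LinearMap.smul_apply, LinearMap.comp_apply, Module.End.smul_def,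
    LinearMap.proj_apply]
  rw [← map_sum, ← map_sum]
  simp only [LinearMap.single_apply, LinearMap.sum_single_apply, hx]

lemma IsSummandOfFiniteSum.of_linearEquiv (hX : IsSummandOfFiniteSum R J X) (e : X ≃ₗ[R] Y) :
    IsSummandOfFiniteSum R J Y := by
  obtain ⟨n, i, r, h⟩ := hX
  refine ⟨n, i ∘ₗ e.symm.toLinearMap, e.toLinearMap ∘ₗ r, LinearMap.ext fun y => ?_⟩
  simpa using congrArg e (LinearMap.congr_fun h (e.symm y))

lemma IsSummandOfFiniteSum.of_subsingleton [Subsingleton X] : IsSummandOfFiniteSum R J X :=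
  ⟨0, 0, 0, LinearMap.ext fun _ => Subsingleton.elim _ _⟩

/-- The dual basis splits the surjection `Eⁿ → Hom_R(X, J)` given by the coordinates. -/
lemma IsSummandOfFiniteSum.projective_dual (hX : IsSummandOfFiniteSum R J X) :
    Module.Projective (Module.End R J) (X →ₗ[R] J) := by
  obtain ⟨n, i, r, h⟩ := hX
  let s : (X →ₗ[R] J) →ₗ[Module.End R J] (Fin n → Module.End R J) :=
    { toFun := fun φ k => φ ∘ₗ r ∘ₗ LinearMap.single R (fun _ => J) k
      map_add' := fun _ _ => rfl
      map_smul' := fun _ _ => rfl }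
  let t : (Fin n → Module.End R J) →ₗ[Module.End R J] (X →ₗ[R] J) :=
    Fintype.linearCombination (Module.End R J) fun k => LinearMap.proj k ∘ₗ i
  exact Module.Projective.of_split s t
    (LinearMap.ext fun φ => (eq_sum_smul_coordinates h φ).symm)

lemma IsSummandOfFiniteSum.evalHom_bijective (hX : IsSummandOfFiniteSum R J X) :
    Function.Bijective (evalHom R (Module.End R J) J X) := by
  obtain ⟨n, i, r, h⟩ := hX
  constructor
  · refine (injective_iff_map_eq_zero _).2 fun x hx => ?_
    have hi : i x = 0 := funext fun k => 
      LinearMap.congr_fun hx ((LinearMap.proj k : (Fin n → J) →ₗ[R] J) ∘ₗ i)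
    exact (LinearMap.congr_fun h x).symm.trans ((congrArg r hi).trans (map_zero r))
  · intro Ψ
    -- The choice is forced: if `Ψ` is evaluation at `x`, its values on the coordinates form `i x`,
    -- and `r (i x) = x`.
    refine ⟨r fun k => Ψ (LinearMap.proj k ∘ₗ i), LinearMap.ext fun φ => ?_⟩
    conv_rhs => rw [eq_sum_smul_coordinates h φ]
    simp only [map_sum, map_smul, Module.End.smul_def, LinearMap.comp_apply]
    rw [← map_sum, ← map_sum]
    simp only [LinearMap.single_apply, LinearMap.sum_single_apply]
    rfl

end Summand

/-! ### K-projective resolutions of the dual and the derived evaluation -/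

section Resolution

variable {R : Type u} [Ring R] (J : Type v) [AddCommGroup J] [Module R J]

lemma isIso_eval {C : CochainComplex (ModuleCat.{v} R) ℤ}
    (hC : ∀ n, IsSummandOfFiniteSum R J (C.X n)) : IsIso (eval R (Module.End R J) J C) := by
  have (p : ℤ) : IsIso ((eval R (Module.End R J) J C).f p) := by
    have : IsIso (ModuleCat.ofHom (evalHom R (Module.End R J) J (C.X (-(-p))))) :=
      (ConcreteCategory.isIso_iff_bijective _).2 (hC _).evalHom_bijective
    have : IsIso (unsignedEval R (Module.End R J) J C p) := IsIso.comp_isIso' inferInstance this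
    rw [eval_f]
    rcases Int.even_or_odd p with hp | hp
    · rwa [Int.negOnePow_even _ hp, one_smul]
    · rw [Int.negOnePow_odd _ hp, Units.neg_smul, one_smul]
      exact (-asIso (unsignedEval R (Module.End R J) J C p)).isIso_hom
  exact HomologicalComplex.Hom.isIso_of_components _

/-- Dualizing turns bounded below into bounded above, and bounded above complexes of projectives are
K-projective. -/
lemma isKProjective_derivedDual {C : CochainComplex (ModuleCat.{v} R) ℤ} [C.IsStrictlyGE 0]
    (hC : ∀ n, IsSummandOfFiniteSum R J (C.X n)) : (derivedDual R J C).IsKProjective := by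
  have (n : ℤ) : Projective ((derivedDual R J C).X n) :=
    (IsProjective.iff_projective (R := Module.End R J) (C.X (-n) →ₗ[R] J)).1
      (hC (-n)).projective_dual
  have : (derivedDual R J C).IsStrictlyLE 0 := by
    rw [CochainComplex.isStrictlyLE_iff]
    intro n hn
    have := ModuleCat.subsingleton_of_isZero (C.isZero_of_isStrictlyGE 0 (-n) (by omega))
    exact ModuleCat.isZero_of_iff_subsingleton.2
      (inferInstanceAs (Subsingleton (C.X (-n) →ₗ[R] J)))
  exact CochainComplex.isKProjective_of_projective _ 0

/-- The K-projective resolution of `C^⊛` given by the dual of a resolution `C → D` whose terms are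
summands of finite sums of copies of `J`. -/
def KProjectiveResolution.ofQuasiIso (hJ : Module.Injective R J)
    {C D : CochainComplex (ModuleCat.{v} R) ℤ} (f : C ⟶ D) [QuasiIso f] [D.IsStrictlyGE 0]
    (hD : ∀ n, IsSummandOfFiniteSum R J (D.X n)) :
    KProjectiveResolution (derivedDual R J C) where
  P := derivedDual R J D
  isKProjective := isKProjective_derivedDual J hD
  π := dualMap R (Module.End R J) J f
  quasiIso := quasiIso_dualMap _ hJ f

lemma quasiIso_derivedEval_ofQuasiIso (hJ : Module.Injective R J)
    {C D : CochainComplex (ModuleCat.{v} R) ℤ} (f : C ⟶ D) [QuasiIso f] [D.IsStrictlyGE 0]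
    (hD : ∀ n, IsSummandOfFiniteSum R J (D.X n)) :
    QuasiIso (derivedEval J (KProjectiveResolution.ofQuasiIso J hJ f hD)) := by
  have := isIso_eval J hD
  have h : QuasiIso (eval R (Module.End R J) J C ≫
      dualMap (Module.End R J) R J (dualMap R (Module.End R J) J f)) := by
    rw [← eval_naturality]
    infer_instance
  exact h

variable {J}

attribute [local instance] HasDerivedCategory.standard in
/-- K-projective resolutions of a complex are compared by a homotopy equivalence, which is
compatible with the augmentations up to homotopy. -/
lemma KProjectiveResolution.exists_homotopyEquivalence {A : Type u} [Ring A]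
    {N : CochainComplex (ModuleCat.{v} A) ℤ} (Q Q' : KProjectiveResolution N) :
    ∃ f : Q.P ⟶ Q'.P, HomologicalComplex.homotopyEquivalences _ _ f ∧
      Nonempty (Homotopy (f ≫ Q'.π) Q.π) := by
  have := Q.isKProjective
  have := Q'.isKProjective
  have := Q.quasiIso
  have := Q'.quasiIso
  let q := HomotopyCategory.quotient (ModuleCat.{v} A) (.up ℤ)
  have : IsIso (DerivedCategory.Qh.map (q.map Q'.π)) :=
    (NatIso.isIso_map_iff (DerivedCategory.quotientCompQhIso _) Q'.π).2 inferInstance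
  -- Out of a K-projective complex, homotopy classes of maps agree with morphisms in the derived
  -- category: surjectivity produces `f`, injectivity the homotopy.
  obtain ⟨g, hg⟩ := (CochainComplex.IsKProjective.Qh_map_bijective Q.P (q.obj Q'.P)).surjective
    (DerivedCategory.Qh.map (q.map Q.π) ≫ inv (DerivedCategory.Qh.map (q.map Q'.π)))
  obtain ⟨f, rfl⟩ := q.map_surjective g
  have hf : q.map (f ≫ Q'.π) = q.map Q.π := by
    apply (CochainComplex.IsKProjective.Qh_map_bijective Q.P (q.obj N)).injective
    rw [Functor.map_comp, Functor.map_comp, hg, Category.assoc, IsIso.inv_hom_id, Category.comp_id]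
  have h := HomotopyCategory.homotopyOfEq _ _ hf
  have : QuasiIso (f ≫ Q'.π) := quasiIso_of_homotopy h.symm
  exact ⟨f, (CochainComplex.IsKProjective.quasiIso_iff f).1 (quasiIso_of_comp_right f Q'.π), ⟨h⟩⟩

/-- Whether the derived evaluation map is a quasi-isomorphism does not depend on the choice of the
K-projective resolution. -/
lemma quasiIso_derivedEval_of_quasiIso {C : CochainComplex (ModuleCat.{v} R) ℤ}
    (Q Q' : KProjectiveResolution (derivedDual R J C)) (h : QuasiIso (derivedEval J Q)) :
    QuasiIso (derivedEval J Q') := by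
  obtain ⟨f, hf, ⟨H⟩⟩ := Q.exists_homotopyEquivalence Q'
  have := quasiIso_dualMap_of_homotopyEquivalences (Module.End R J) R J hf
  have H' : Homotopy (derivedEval J Q' ≫ dualMap (Module.End R J) R J f) (derivedEval J Q) :=
    (dualHomotopy (Module.End R J) R J H).compLeft (eval R (Module.End R J) J C)
  have : QuasiIso (derivedEval J Q' ≫ dualMap (Module.End R J) R J f) := quasiIso_of_homotopy H'.symm
  exact quasiIso_of_comp_right _ (dualMap (Module.End R J) R J f)

lemma isSummandOfFiniteSum_cochainComplex {M : ModuleCat.{v} R} (I : InjectiveResolution M)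
    (hI : ∀ i : ℕ, IsSummandOfFiniteSum R J (I.cocomplex.X i)) (n : ℤ) :
    IsSummandOfFiniteSum R J (I.cochainComplex.X n) := by
  by_cases hn : 0 ≤ n
  · obtain ⟨k, rfl⟩ := Int.eq_ofNat_of_zero_le hn
    exact (hI k).of_linearEquiv (I.cochainComplexXIso k k rfl).symm.toLinearEquiv
  -- In negative degrees the resolution is extended by zero.
  · have := ModuleCat.subsingleton_of_isZero
      (I.cochainComplex.isZero_of_isStrictlyGE 0 n (by omega))
    exact .of_subsingleton

end Resolution

end DerivedBidual

end

theorem mainTheorem10 {R : Type u} [Ring R] [Small.{v} R]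
    (J : Type v) [AddCommGroup J] [Module R J] (hJ : Module.Injective R J)
    (M : ModuleCat.{v} R) (I : InjectiveResolution M)
    (hI : ∀ i : ℕ, DerivedBidual.IsSummandOfFiniteSum R J (I.cocomplex.X i)) :
    Nonempty (DerivedBidual.KProjectiveResolution (DerivedBidual.derivedDual R J
        ((CochainComplex.singleFunctor (ModuleCat.{v} R) 0).obj M))) ∧
      ∀ Q : DerivedBidual.KProjectiveResolution (DerivedBidual.derivedDual R J
          ((CochainComplex.singleFunctor (ModuleCat.{v} R) 0).obj M)),
        QuasiIso (DerivedBidual.derivedEval J Q) := by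
  have h := DerivedBidual.isSummandOfFiniteSum_cochainComplex I hI
  exact ⟨⟨.ofQuasiIso J hJ I.ι' h⟩, fun Q =>
    DerivedBidual.quasiIso_derivedEval_of_quasiIso _ Q
      (DerivedBidual.quasiIso_derivedEval_ofQuasiIso J hJ I.ι' h)⟩
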